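/- Let $n,m\ge 1$ be integers. Let $\Omega\subset\mathbb R^n$ be a nonempty, bounded, connected open set with Lipschitz boundary, and let $D\subset\Omega$ be measurable with $|\Omega\setminus D|>0$. Let $p\in(1,\infty)$, $s\in(0,1)$, $l\in\{0,1\}$, $\alpha>0$, $z\ge 0$. Let $\rho\in C_c^\infty(\mathbb R^n;\mathbb R)$ be non-negative and radially symmetric with $\int_{\mathbb R^n}\rho\,dx=1$, and suppose that $\{x:\rho(x)\ge\tau\}=\{x:|x|\le\eta\}$ for some $0<\tau<\|\rho\|_{L^\infty}$ and some $\eta>0$. Let $\|\cdot\|_F$ be the Frobenius norm on $\mathbb R^{m\times m}$ and, for a symmetric positive definite matrix $A$ with eigenvalues $\mu_1,\dots,\mu_m$ and orthogonal eigendecomposition $A=V\,\mathrm{diag}(\mu_1,\dots,\mu_m)V^T$, let $\mathrm{Log}(A)=V\,\mathrm{diag}(\log\mu_1,\dots,\log\mu_m)V^T$. Let $\mathrm{SPD}^{\mathrm{Log}}_z$ be the set of symmetric positive definite $A\in\mathbb R^{m\times m}$ with $\|\mathrm{Log}(A)\|_F\le z$, and equip it with the log-Euclidean metric $d(A,B)=\|\mathrm{Log}(A)-\mathrm{Log}(B)\|_F$.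 For $K\subset\mathbb R^{m\times m}$ let $L^p(\Omega;K)$ be the set of $w\in L^p(\Omega;\mathbb R^{m\times m})$ with $w(x)\in K$ for a.e. $x\in\Omega$, and let $W^{s,p}(\Omega;K)$ be the set of those $w\in L^p(\Omega;K)$ for which $(x,y)\mapsto \|w(x)-w(y)\|_F/|x-y|^{n/p+s}$ belongs to $L^p(\Omega\times\Omega)$; functions that agree almost everywhere are identified. Let $w^\delta\in L^p(\Omega;\mathrm{SPD}^{\mathrm{Log}}_z)$ and define $$\mathcal F(w)=\int_{\Omega}\chi_{\Omega\setminus D}(x)\,d^p\big(w(x),w^\delta(x)\big)\,dx+\alpha\int_{\Omega\times\Omega}\frac{d^p\big(w(x),w(y)\big)}{|x-y|^{n+ps}}\,\rho^l(x-y)\,d(x,y).$$ Then $\mathcal F$ has exactly one minimizer over $W^{s,p}(\Omega;\mathrm{SPD}^{\mathrm{Log}}_z)$. -/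

import Mathlib

open MeasureTheory
open scoped ENNReal NNReal ContDiff

/- Matrices carry the Frobenius norm throughout. -/
attribute [local instance] Matrix.frobeniusNormedAddCommGroup

noncomputable section

/-- The Euclidean space `ℝⁿ`. -/
abbrev Rn (n : ℕ) : Type := EuclideanSpace ℝ (Fin n)

/-- Real `m × m` matrices. -/
abbrev Mat (m : ℕ) : Type := Matrix (Fin m) (Fin m) ℝ

/-- Every boundary point of `Ω` has a ball in which, for some unit vector `e`, the set `Ω` is the
region strictly above the graph, in direction `e`, of a Lipschitz function of the component
orthogonal to `e`. -/
def HasLipschitzBoundary {n : ℕ} (Ω : Set (Rn n)) : Prop :=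
  ∀ x ∈ frontier Ω, ∃ r : ℝ, 0 < r ∧ ∃ e : Rn n, ‖e‖ = 1 ∧
    ∃ (L : ℝ≥0) (g : Rn n → ℝ), LipschitzWith L g ∧
      ∀ y ∈ Metric.ball x r, (y ∈ Ω ↔ g (y - inner ℝ e y • e) < inner ℝ e y)

/-- Mollifiers: smooth, compactly supported, non-negative, radially symmetric functions of
integral one that have a superlevel set, at a positive level below the supremum norm, which is a
closed ball of positive radius around the origin. -/
structure IsMollifier {n : ℕ} (ρ : Rn n → ℝ) : Prop where
  contDiff : ContDiff ℝ ∞ ρ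
  hasCompactSupport : HasCompactSupport ρ
  nonneg : ∀ x, 0 ≤ ρ x
  radial : ∀ x y, ‖x‖ = ‖y‖ → ρ x = ρ y
  integral_eq_one : ∫ x, ρ x = 1
  superlevel : ∃ τ : ℝ, 0 < τ ∧ ENNReal.ofReal τ < eLpNorm ρ ∞ volume ∧
    ∃ η : ℝ, 0 < η ∧ {x | τ ≤ ρ x} = Metric.closedBall 0 η

/-- The matrix logarithm of a symmetric positive definite matrix: the scalar logarithm applied to
the eigenvalues in an orthogonal eigendecomposition. -/
def matLog {m : ℕ} (A : Mat m) : Mat m := cfc Real.log A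

/-- The log-Euclidean distance `‖Log A - Log B‖_F`. -/
def logDist {m : ℕ} (A B : Mat m) : ℝ := ‖matLog A - matLog B‖

/-- Symmetric positive definite matrices whose logarithm has Frobenius norm at most `z`. -/
def SPDLog (m : ℕ) (z : ℝ) : Set (Mat m) := {A | A.PosDef ∧ ‖matLog A‖ ≤ z}

/-- The space `L^p(Ω; ℝ^{m × m})` of equivalence classes of functions. -/
abbrev LpMat {n : ℕ} (m : ℕ) (Ω : Set (Rn n)) (p : ℝ) : Type :=
  Lp (Mat m) (ENNReal.ofReal p) (volume.restrict Ω)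

/-- The Lebesgue set `L^p(Ω; K)`. -/
def lebesgueSet {n m : ℕ} (Ω : Set (Rn n)) (p : ℝ) (K : Set (Mat m)) : Set (LpMat m Ω p) :=
  {w | ∀ᵐ x ∂(volume.restrict Ω), w x ∈ K}

/-- The fractional Sobolev space `W^{s,p}(Ω; ℝ^{m × m})`, as a subset of `L^p`. -/
def fracSobolev {n : ℕ} (m : ℕ) (Ω : Set (Rn n)) (s p : ℝ) : Set (LpMat m Ω p) :=
  {w | MemLp (fun q : Rn n × Rn n => ‖w q.1 - w q.2‖ / ‖q.1 - q.2‖ ^ ((n : ℝ) / p + s))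
    (ENNReal.ofReal p) ((volume.restrict Ω).prod (volume.restrict Ω))}

/-- The fractional Sobolev set `W^{s,p}(Ω; K)`. -/
def fracSobolevSet {n m : ℕ} (Ω : Set (Rn n)) (s p : ℝ) (K : Set (Mat m)) :
    Set (LpMat m Ω p) :=
  {w | w ∈ fracSobolev m Ω s p ∧ ∀ᵐ x ∂(volume.restrict Ω), w x ∈ K}

/-- The regularizer
`Φ(w) = ∫_{Ω × Ω} d(w(x), w(y))^p / |x - y|^{n + p s} * ρ(x - y)^l d(x,y)`, with values in
`[0, ∞]`. -/
def regularizer {n m : ℕ} (Ω : Set (Rn n)) (s p : ℝ) (ρ : Rn n → ℝ) (l : ℕ)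
    (w : Rn n → Mat m) : ℝ≥0∞ :=
  ∫⁻ q : Rn n × Rn n,
    ENNReal.ofReal
      (logDist (w q.1) (w q.2) ^ p / ‖q.1 - q.2‖ ^ ((n : ℝ) + p * s) * ρ (q.1 - q.2) ^ l)
    ∂((volume.restrict Ω).prod (volume.restrict Ω))

/-- The functional
`F(w) = ∫_Ω χ_{Ω \ D}(x) d(w(x), v(x))^p dx + α Φ(w)`, with values in `[0, ∞]`. -/
def functionalF {n m : ℕ} (Ω D : Set (Rn n)) (s p α : ℝ) (ρ : Rn n → ℝ) (l : ℕ)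
    (v w : Rn n → Mat m) : ℝ≥0∞ :=
  (∫⁻ x in Ω, (Ω \ D).indicator (fun x => ENNReal.ofReal (logDist (w x) (v x) ^ p)) x)
    + ENNReal.ofReal α * regularizer Ω s p ρ l w

end

/-!
In the logarithmic coordinate `u = Log w` the functional becomes a convex energy on the maps with
values in a closed convex ball of symmetric matrices. This ball is bounded, so whatever `p` is, the
direct method can be run in the Hilbert space `L²`: the Frobenius norm satisfies the parallelogram
law, and nested nonempty bounded closed convex sublevel sets of a Hilbert space have a common point,
because their points of minimal norm form a Cauchy sequence.

Strict convexity of `‖·‖ᵖ` forces two minimizers to agree on `Ω \ D` and to have equal increments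
over short distances, on which the mollifier is positive. Their difference is then locally constant
almost everywhere, hence constant since `Ω` is connected, and zero since `Ω \ D` is not null.

A map of finite energy lies in the fractional Sobolev space: the exponential is Lipschitz on bounded
sets, the kernel is bounded below near the diagonal, and away from the diagonal the difference
quotients are bounded.
-/

open Filter Topology

section StrictConvexity

variable {E : Type*} [NormedAddCommGroup E] [NormedSpace ℝ E] [StrictConvexSpace ℝ E]
  {p : ℝ} {x y : E} {a b : ℝ}

theorem strictConvexOn_norm_rpow (hp : 1 < p) :
    StrictConvexOn ℝ Set.univ (fun x : E => ‖x‖ ^ p) := by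
  refine ⟨convex_univ, fun x _ y _ hxy a b ha hb hab => ?_⟩
  have hp0 : 0 < p := by linarith
  simp only [smul_eq_mul]
  by_cases h : ‖x‖ = ‖y‖
  · have hlt : ‖a • x + b • y‖ < ‖y‖ := norm_combo_lt_of_ne h.le le_rfl hxy ha hb hab
    rw [h, ← add_mul, hab, one_mul]
    exact Real.rpow_lt_rpow (norm_nonneg _) hlt hp0
  · have hle : ‖a • x + b • y‖ ≤ a * ‖x‖ + b * ‖y‖ := by
      simpa only [smul_eq_mul] using
        convexOn_univ_norm.2 (Set.mem_univ x) (Set.mem_univ y) ha.le hb.le hab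
    exact (Real.rpow_le_rpow (norm_nonneg _) hle hp0.le).trans_lt
      ((strictConvexOn_rpow hp).2 (norm_nonneg x) (norm_nonneg y) h ha hb hab)

theorem enorm_rpow_eq_ofReal {E : Type*} [SeminormedAddCommGroup E] (x : E) (hp : 0 ≤ p) :
    ‖x‖ₑ ^ p = ENNReal.ofReal (‖x‖ ^ p) := by
  rw [← ofReal_norm, ENNReal.ofReal_rpow_of_nonneg (norm_nonneg _) hp]

theorem combo_enorm_rpow_eq_ofReal {E : Type*} [SeminormedAddCommGroup E] (x y : E)
    (hp : 0 ≤ p) (ha : 0 ≤ a) (hb : 0 ≤ b) :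
    ENNReal.ofReal a * ‖x‖ₑ ^ p + ENNReal.ofReal b * ‖y‖ₑ ^ p =
      ENNReal.ofReal (a * ‖x‖ ^ p + b * ‖y‖ ^ p) := by
  rw [ENNReal.ofReal_add (by positivity) (by positivity), ENNReal.ofReal_mul ha,
    ENNReal.ofReal_mul hb, enorm_rpow_eq_ofReal x hp, enorm_rpow_eq_ofReal y hp]

theorem enorm_combo_rpow_le (hp : 1 < p) (x y : E) (ha : 0 ≤ a) (hb : 0 ≤ b) (hab : a + b = 1) :
    ‖a • x + b • y‖ₑ ^ p ≤ ENNReal.ofReal a * ‖x‖ₑ ^ p + ENNReal.ofReal b * ‖y‖ₑ ^ p := by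
  have hp0 : 0 ≤ p := by linarith
  rw [enorm_rpow_eq_ofReal _ hp0, combo_enorm_rpow_eq_ofReal x y hp0 ha hb]
  exact ENNReal.ofReal_le_ofReal
    ((strictConvexOn_norm_rpow hp).convexOn.2 (Set.mem_univ x) (Set.mem_univ y) ha hb hab)

theorem eq_of_enorm_combo_rpow_eq (hp : 1 < p) (ha : 0 < a) (hb : 0 < b) (hab : a + b = 1)
    (h : ‖a • x + b • y‖ₑ ^ p = ENNReal.ofReal a * ‖x‖ₑ ^ p + ENNReal.ofReal b * ‖y‖ₑ ^ p) :
    x = y := by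
  have hp0 : 0 ≤ p := by linarith
  rw [enorm_rpow_eq_ofReal _ hp0, combo_enorm_rpow_eq_ofReal x y hp0 ha.le hb.le,
    ENNReal.ofReal_eq_ofReal_iff (by positivity) (by positivity)] at h
  by_contra hxy
  exact ((strictConvexOn_norm_rpow hp).2 (Set.mem_univ x) (Set.mem_univ y) hxy ha hb hab).ne h

end StrictConvexity

section LintegralEnormRpow

variable {Y E : Type*} [MeasurableSpace Y] {μ : Measure Y} {p : ℝ} [NormedAddCommGroup E]
  {U V : Y → E} {a b : ℝ}

theorem lintegral_enorm_rpow_le_liminf {U : ℕ → Y → E} (hU : ∀ j, AEStronglyMeasurable (U j) μ)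
    (hlim : ∀ᵐ y ∂μ, Tendsto (fun j => U j y) atTop (𝓝 (V y))) :
    ∫⁻ y, ‖V y‖ₑ ^ p ∂μ ≤ liminf (fun j => ∫⁻ y, ‖U j y‖ₑ ^ p ∂μ) atTop := by
  refine le_trans (lintegral_mono_ae ?_) (lintegral_liminf_le' fun j => (hU j).enorm.pow_const p)
  filter_upwards [hlim] with y hy
  exact ((ENNReal.continuous_rpow_const.tendsto _).comp hy.enorm).liminf_eq.ge

theorem lintegral_combo_enorm_rpow (hU : AEStronglyMeasurable U μ) (hV : AEStronglyMeasurable V μ)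
    (c d : ℝ≥0∞) :
    ∫⁻ y, (c * ‖U y‖ₑ ^ p + d * ‖V y‖ₑ ^ p) ∂μ =
      c * ∫⁻ y, ‖U y‖ₑ ^ p ∂μ + d * ∫⁻ y, ‖V y‖ₑ ^ p ∂μ := by
  rw [lintegral_add_left' ((hU.enorm.pow_const p).const_mul c),
    lintegral_const_mul'' _ (hU.enorm.pow_const p), lintegral_const_mul'' _ (hV.enorm.pow_const p)]

variable [NormedSpace ℝ E] [StrictConvexSpace ℝ E]

theorem lintegral_enorm_combo_rpow_le (hp : 1 < p) (hU : AEStronglyMeasurable U μ)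
    (hV : AEStronglyMeasurable V μ) (ha : 0 ≤ a) (hb : 0 ≤ b) (hab : a + b = 1) :
    ∫⁻ y, ‖a • U y + b • V y‖ₑ ^ p ∂μ ≤
      ENNReal.ofReal a * ∫⁻ y, ‖U y‖ₑ ^ p ∂μ + ENNReal.ofReal b * ∫⁻ y, ‖V y‖ₑ ^ p ∂μ := by
  rw [← lintegral_combo_enorm_rpow hU hV]
  exact lintegral_mono fun y => enorm_combo_rpow_le hp _ _ ha hb hab

theorem ae_eq_of_le_lintegral_enorm_combo_rpow (hp : 1 < p) (hU : AEStronglyMeasurable U μ)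
    (hV : AEStronglyMeasurable V μ) (ha : 0 < a) (hb : 0 < b) (hab : a + b = 1)
    (hfin : ∫⁻ y, ‖a • U y + b • V y‖ₑ ^ p ∂μ ≠ ⊤)
    (h : ENNReal.ofReal a * ∫⁻ y, ‖U y‖ₑ ^ p ∂μ + ENNReal.ofReal b * ∫⁻ y, ‖V y‖ₑ ^ p ∂μ ≤
      ∫⁻ y, ‖a • U y + b • V y‖ₑ ^ p ∂μ) :
    U =ᵐ[μ] V := by
  rw [← lintegral_combo_enorm_rpow hU hV] at h
  have hmeas : AEMeasurable
      (fun y => ENNReal.ofReal a * ‖U y‖ₑ ^ p + ENNReal.ofReal b * ‖V y‖ₑ ^ p) μ :=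
    ((hU.enorm.pow_const p).const_mul _).add ((hV.enorm.pow_const p).const_mul _)
  filter_upwards [ae_eq_of_ae_le_of_lintegral_le
    (.of_forall fun y => enorm_combo_rpow_le hp _ _ ha.le hb.le hab) hfin hmeas h] with y hy
  exact eq_of_enorm_combo_rpow_eq hp ha hb hab hy

end LintegralEnormRpow

section DirectMethod

variable {H : Type*} [NormedAddCommGroup H] [InnerProductSpace ℝ H] [CompleteSpace H]

theorem exists_forall_norm_sub_sq_le {C : Set H} (hne : C.Nonempty) (hcl : IsClosed C)
    (hconv : Convex ℝ C) : ∃ v ∈ C, ∀ w ∈ C, ‖w - v‖ ^ 2 ≤ ‖w‖ ^ 2 - ‖v‖ ^ 2 := by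
  obtain ⟨v, hv, hmin⟩ := exists_norm_eq_iInf_of_complete_convex hne hcl.isComplete hconv 0
  refine ⟨v, hv, fun w hw => ?_⟩
  have hinner := (norm_eq_iInf_iff_real_inner_le_zero hconv hv).1 hmin w hw
  rw [zero_sub, inner_neg_left, inner_sub_right, real_inner_self_eq_norm_sq] at hinner
  rw [norm_sub_sq_real, real_inner_comm]
  linarith

theorem nonempty_iInter_of_antitone_convex {C : ℕ → Set H} (hC : Antitone C)
    (hne : ∀ j, (C j).Nonempty) (hcl : ∀ j, IsClosed (C j)) (hconv : ∀ j, Convex ℝ (C j))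
    (hb : Bornology.IsBounded (C 0)) : (⋂ j, C j).Nonempty := by
  choose v hv hmin using fun j => exists_forall_norm_sub_sq_le (hne j) (hcl j) (hconv j)
  have hdist : ∀ i j, i ≤ j → ‖v j - v i‖ ^ 2 ≤ ‖v j‖ ^ 2 - ‖v i‖ ^ 2 :=
    fun i j hij => hmin i (v j) (hC hij (hv j))
  have hmono : Monotone fun j => ‖v j‖ ^ 2 :=
    fun i j hij => sub_nonneg.1 ((sq_nonneg _).trans (hdist i j hij))
  obtain ⟨R, hR⟩ := hb.exists_norm_le
  have hbdd : BddAbove (Set.range fun j => ‖v j‖ ^ 2) :=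
    ⟨R ^ 2, Set.forall_mem_range.2 fun j =>
      pow_le_pow_left₀ (norm_nonneg _) (hR _ (hC j.zero_le (hv j))) 2⟩
  have hcauchy : CauchySeq v := by
    refine Metric.cauchySeq_iff'.2 fun ε hε => ?_
    obtain ⟨N, hN⟩ :=
      Metric.cauchySeq_iff'.1 (tendsto_atTop_ciSup hmono hbdd).cauchySeq (ε ^ 2) (by positivity)
    refine ⟨N, fun j hj => ?_⟩
    rw [dist_eq_norm]
    refine lt_of_pow_lt_pow_left₀ 2 hε.le ((hdist N j hj).trans_lt ?_)
    exact (le_abs_self _).trans_lt (hN j hj)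
  obtain ⟨u, hu⟩ := cauchySeq_tendsto_of_complete hcauchy
  exact ⟨u, Set.mem_iInter.2 fun i => (hcl i).mem_of_tendsto hu
    (Filter.eventually_atTop.2 ⟨i, fun j hj => hC hj (hv j)⟩)⟩

theorem exists_isMinOn_of_quasiconvexOn {β : Type*} [CompleteLinearOrder β] [TopologicalSpace β]
    [OrderTopology β] [FirstCountableTopology β] {S : Set H} {G : H → β} (hne : S.Nonempty)
    (hcl : IsClosed S) (hb : Bornology.IsBounded S) (hconv : QuasiconvexOn ℝ S G)
    (hlsc : LowerSemicontinuous G) : ∃ u ∈ S, IsMinOn G S u := by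
  obtain ⟨c, hc_anti, hc_lim, hc_mem⟩ :=
    exists_seq_tendsto_sInf (hne.image G) (OrderBot.bddBelow _)
  obtain ⟨u, hu⟩ := nonempty_iInter_of_antitone_convex (C := fun j => {u ∈ S | G u ≤ c j})
    (fun i j hij u hu => ⟨hu.1, hu.2.trans (hc_anti hij)⟩)
    (fun j => (hc_mem j).imp fun u hu => ⟨hu.1, hu.2.le⟩)
    (fun j => hcl.inter (hlsc.isClosed_preimage (c j))) (fun j => hconv (c j))
    (hb.subset fun u hu => hu.1)
  rw [Set.mem_iInter] at hu
  exact ⟨u, (hu 0).1, fun w hw =>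
    (ge_of_tendsto' hc_lim fun j => (hu j).2).trans (sInf_le ⟨w, hw, rfl⟩)⟩

theorem lowerSemicontinuous_Lp_of_le_liminf {X E : Type*} [MeasurableSpace X]
    [NormedAddCommGroup E] {μ : Measure X} {r : ℝ≥0∞} [Fact (1 ≤ r)] {G : (X → E) → ℝ≥0∞}
    (hG : ∀ (u : ℕ → Lp E r μ) (v : Lp E r μ),
      (∀ᵐ x ∂μ, Tendsto (fun j => u j x) atTop (𝓝 (v x))) →
        G v ≤ liminf (fun j => G (u j)) atTop) :
    LowerSemicontinuous fun v : Lp E r μ => G v := by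
  refine lowerSemicontinuous_iff_isClosed_preimage.2 fun c => ?_
  refine IsSeqClosed.isClosed fun u v hu huv => ?_
  obtain ⟨φ, -, hφ⟩ := (tendstoInMeasure_of_tendsto_Lp huv).exists_seq_tendsto_ae
  exact (hG (fun j => u (φ j)) v hφ).trans
    (liminf_le_of_frequently_le' (Frequently.of_forall fun j => hu (φ j)))

end DirectMethod

section Combinations

variable {X E : Type*} [AddCommGroup E] [Module ℝ E] {a b : ℝ}

theorem combo_sub_eq_combo_sub (f u v : X → E) (hab : a + b = 1) (x : X) :
    (a • u + b • v) x - f x = a • (u x - f x) + b • (v x - f x) := by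
  conv_lhs => rw [← one_smul ℝ (f x), ← hab]
  simp only [Pi.add_apply, Pi.smul_apply]
  module

theorem increment_combo (a b : ℝ) (u v : X → E) (x y : X) :
    (a • u + b • v) x - (a • u + b • v) y = a • (u x - u y) + b • (v x - v y) := by
  simp only [Pi.add_apply, Pi.smul_apply]
  module

theorem ofReal_mul_add_ofReal_mul_le {s t c : ℝ≥0∞} (hs : s ≤ c) (ht : t ≤ c) (ha : 0 ≤ a)
    (hb : 0 ≤ b) (hab : a + b = 1) : ENNReal.ofReal a * s + ENNReal.ofReal b * t ≤ c :=
  calc ENNReal.ofReal a * s + ENNReal.ofReal b * t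
      ≤ ENNReal.ofReal a * c + ENNReal.ofReal b * c := by gcongr
    _ = c := by rw [← add_mul, ← ENNReal.ofReal_add ha hb, hab, ENNReal.ofReal_one, one_mul]

end Combinations

section PairEnergy

/-- The pair energy `∫ ‖u - f‖ᵖ dμ + ∫ ‖u x - u y‖ᵖ dκ(x, y)` of a map `u`: a fidelity term with
respect to the datum `f` plus a nonlocal regularization term. Weights and kernels are absorbed into
the measures `μ` and `κ`. -/
noncomputable def pairEnergy {X E : Type*} [MeasurableSpace X] [NormedAddCommGroup E]
    (μ : Measure X) (κ : Measure (X × X)) (p : ℝ) (f u : X → E) : ℝ≥0∞ :=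
  ∫⁻ x, ‖u x - f x‖ₑ ^ p ∂μ + ∫⁻ q, ‖u q.1 - u q.2‖ₑ ^ p ∂κ

/-- The almost everywhere strongly measurable maps with values in `K` almost everywhere: the
admissible class for the minimization of a pair energy. -/
def aeMapsInto {X E : Type*} [MeasurableSpace X] [TopologicalSpace E] (ν : Measure X) (K : Set E) :
    Set (X → E) :=
  {u | AEStronglyMeasurable u ν ∧ ∀ᵐ x ∂ν, u x ∈ K}

theorem aeMapsInto_congr_ae {X E : Type*} [MeasurableSpace X] [TopologicalSpace E] {ν : Measure X}
    {K : Set E} {u v : X → E} (h : u =ᵐ[ν] v) : u ∈ aeMapsInto ν K ↔ v ∈ aeMapsInto ν K :=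
  and_congr (aestronglyMeasurable_congr h) (eventually_congr (h.mono fun _ hx => by rw [hx]))

variable {X E : Type*} [MeasurableSpace X] {ν μ : Measure X} {κ : Measure (X × X)}
  [NormedAddCommGroup E] {p : ℝ} {f u v : X → E} {K : Set E}

theorem tendsto_increment_ae (hκ : κ ≪ ν.prod ν) {u : ℕ → X → E}
    (h : ∀ᵐ x ∂ν, Tendsto (fun j => u j x) atTop (𝓝 (v x))) :
    ∀ᵐ q ∂κ, Tendsto (fun j => u j q.1 - u j q.2) atTop (𝓝 (v q.1 - v q.2)) :=
  hκ.ae_le ((Measure.quasiMeasurePreserving_fst.ae h).and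
    (Measure.quasiMeasurePreserving_snd.ae h) |>.mono fun _ hq => hq.1.sub hq.2)

theorem aestronglyMeasurable_increment (hκ : κ ≪ ν.prod ν)
    (hu : AEStronglyMeasurable u ν) : AEStronglyMeasurable (fun q : X × X => u q.1 - u q.2) κ :=
  (hu.comp_fst.sub hu.comp_snd).mono_ac hκ

theorem pairEnergy_congr_ae (hμ : μ ≪ ν) (hκ : κ ≪ ν.prod ν) (h : u =ᵐ[ν] v) :
    pairEnergy μ κ p f u = pairEnergy μ κ p f v := by
  refine congrArg₂ (· + ·) (lintegral_congr_ae ?_) (lintegral_congr_ae (hκ.ae_le ?_))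
  · filter_upwards [hμ.ae_le h] with x hx
    rw [hx]
  · filter_upwards [Measure.quasiMeasurePreserving_fst.ae h,
      Measure.quasiMeasurePreserving_snd.ae h] with q hq₁ hq₂
    rw [hq₁, hq₂]

theorem lowerSemicontinuous_pairEnergy {r : ℝ≥0∞} [Fact (1 ≤ r)] (hμ : μ ≪ ν)
    (hκ : κ ≪ ν.prod ν) (hf : AEStronglyMeasurable f μ) :
    LowerSemicontinuous fun u : Lp E r ν => pairEnergy μ κ p f u := by
  refine LowerSemicontinuous.add
    (lowerSemicontinuous_Lp_of_le_liminf (G := fun u : X → E => ∫⁻ x, ‖u x - f x‖ₑ ^ p ∂μ)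
      fun u v huv => ?_)
    (lowerSemicontinuous_Lp_of_le_liminf (G := fun u : X → E => ∫⁻ q, ‖u q.1 - u q.2‖ₑ ^ p ∂κ)
      fun u v huv => ?_)
  · exact lintegral_enorm_rpow_le_liminf
      (fun j => ((Lp.aestronglyMeasurable (u j)).mono_ac hμ).sub hf)
      (hμ.ae_le (huv.mono fun x hx => hx.sub_const (f x)))
  · exact lintegral_enorm_rpow_le_liminf
      (fun j => aestronglyMeasurable_increment hκ (Lp.aestronglyMeasurable (u j)))
      (tendsto_increment_ae hκ huv)

variable [NormedSpace ℝ E] {a b : ℝ}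

theorem pairEnergy_combo_le [StrictConvexSpace ℝ E] (hp : 1 < p) (hμ : μ ≪ ν)
    (hκ : κ ≪ ν.prod ν) (hf : AEStronglyMeasurable f μ) (hu : AEStronglyMeasurable u ν)
    (hv : AEStronglyMeasurable v ν) (ha : 0 ≤ a) (hb : 0 ≤ b) (hab : a + b = 1) :
    pairEnergy μ κ p f (a • u + b • v) ≤
      ENNReal.ofReal a * pairEnergy μ κ p f u + ENNReal.ofReal b * pairEnergy μ κ p f v := by
  simp only [pairEnergy, combo_sub_eq_combo_sub f u v hab, increment_combo]
  rw [mul_add, mul_add, add_add_add_comm]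
  exact add_le_add
    (lintegral_enorm_combo_rpow_le hp ((hu.mono_ac hμ).sub hf) ((hv.mono_ac hμ).sub hf) ha hb hab)
    (lintegral_enorm_combo_rpow_le hp (aestronglyMeasurable_increment hκ hu)
      (aestronglyMeasurable_increment hκ hv) ha hb hab)

theorem ae_eq_of_le_pairEnergy_combo [StrictConvexSpace ℝ E] (hp : 1 < p)
    (hμ : μ ≪ ν) (hκ : κ ≪ ν.prod ν) (hf : AEStronglyMeasurable f μ)
    (hu : AEStronglyMeasurable u ν) (hv : AEStronglyMeasurable v ν)
    (ha : 0 < a) (hb : 0 < b) (hab : a + b = 1) (hfin : pairEnergy μ κ p f (a • u + b • v) ≠ ⊤)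
    (h : ENNReal.ofReal a * pairEnergy μ κ p f u + ENNReal.ofReal b * pairEnergy μ κ p f v ≤
      pairEnergy μ κ p f (a • u + b • v)) :
    u =ᵐ[μ] v ∧ ∀ᵐ q ∂κ, u q.1 - u q.2 = v q.1 - v q.2 := by
  have hu₁ := (hu.mono_ac hμ).sub hf
  have hv₁ := (hv.mono_ac hμ).sub hf
  have hu₂ := aestronglyMeasurable_increment hκ hu
  have hv₂ := aestronglyMeasurable_increment hκ hv
  simp only [pairEnergy, combo_sub_eq_combo_sub f u v hab, increment_combo] at h hfin
  rw [mul_add, mul_add, add_add_add_comm] at h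
  obtain ⟨hfin₁, hfin₂⟩ := ENNReal.add_ne_top.1 hfin
  have hle₁ := (ENNReal.add_le_add_iff_right hfin₂).1 ((add_le_add_right
    (lintegral_enorm_combo_rpow_le hp hu₂ hv₂ ha.le hb.le hab) _).trans h)
  have hle₂ := (ENNReal.add_le_add_iff_left hfin₁).1 ((add_le_add_left
    (lintegral_enorm_combo_rpow_le hp hu₁ hv₁ ha.le hb.le hab) _).trans h)
  exact ⟨(ae_eq_of_le_lintegral_enorm_combo_rpow hp hu₁ hv₁ ha hb hab hfin₁ hle₁).mono
      fun x hx => sub_left_inj.1 hx,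
    ae_eq_of_le_lintegral_enorm_combo_rpow hp hu₂ hv₂ ha hb hab hfin₂ hle₂⟩

theorem convex_aeMapsInto (ν : Measure X) (hK : Convex ℝ K) : Convex ℝ (aeMapsInto ν K) :=
  fun _ hu _ hv a b ha hb hab => ⟨(hu.1.const_smul a).add (hv.1.const_smul b),
    (hu.2.and hv.2).mono fun _ hx => hK hx.1 hx.2 ha hb hab⟩

theorem quasiconvexOn_pairEnergy [StrictConvexSpace ℝ E] (hp : 1 < p) (hμ : μ ≪ ν)
    (hκ : κ ≪ ν.prod ν) (hf : AEStronglyMeasurable f μ) (hK : Convex ℝ K) :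
    QuasiconvexOn ℝ (aeMapsInto ν K) (pairEnergy μ κ p f) :=
  fun _ _ hu _ hv _ _ ha hb hab => ⟨convex_aeMapsInto ν hK hu.1 hv.1 ha hb hab,
    (pairEnergy_combo_le hp hμ hκ hf hu.1.1 hv.1.1 ha hb hab).trans
      (ofReal_mul_add_ofReal_mul_le hu.2 hv.2 ha hb hab)⟩

theorem increments_ae_eq_of_isMinOn_pairEnergy [StrictConvexSpace ℝ E] (hp : 1 < p)
    (hμ : μ ≪ ν) (hκ : κ ≪ ν.prod ν) (hf : AEStronglyMeasurable f μ) (hK : Convex ℝ K)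
    (hu : u ∈ aeMapsInto ν K) (hv : v ∈ aeMapsInto ν K)
    (humin : IsMinOn (pairEnergy μ κ p f) (aeMapsInto ν K) u)
    (hvmin : IsMinOn (pairEnergy μ κ p f) (aeMapsInto ν K) v) (hfin : pairEnergy μ κ p f u ≠ ⊤) :
    u =ᵐ[μ] v ∧ ∀ᵐ q ∂κ, u q.1 - u q.2 = v q.1 - v q.2 := by
  have hpos : (0 : ℝ) < 1 / 2 := by norm_num
  have hhalf : (1 / 2 : ℝ) + 1 / 2 = 1 := by norm_num
  have hmid := convex_aeMapsInto ν hK hu hv hpos.le hpos.le hhalf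
  have hvu := hvmin hu
  refine ae_eq_of_le_pairEnergy_combo hp hμ hκ hf hu.1 hv.1 hpos hpos hhalf
    (ne_top_of_le_ne_top hfin ?_) ?_
  · exact (pairEnergy_combo_le hp hμ hκ hf hu.1 hv.1 hpos.le hpos.le hhalf).trans
      (ofReal_mul_add_ofReal_mul_le le_rfl hvu hpos.le hpos.le hhalf)
  · exact ofReal_mul_add_ofReal_mul_le (humin hmid) (hvmin hmid) hpos.le hpos.le hhalf

end PairEnergy

section Existence

variable {X E : Type*} [MeasurableSpace X] {ν μ : Measure X} {κ : Measure (X × X)}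
  [NormedAddCommGroup E] {p : ℝ} {f : X → E} {K : Set E} {r : ℝ≥0∞}

theorem isClosed_setOf_Lp_mem_aeMapsInto [Fact (1 ≤ r)] (hK : IsClosed K) :
    IsClosed {u : Lp E r ν | ⇑u ∈ aeMapsInto ν K} := by
  refine IsSeqClosed.isClosed fun u v hu huv => ?_
  obtain ⟨φ, -, hφ⟩ := (tendstoInMeasure_of_tendsto_Lp huv).exists_seq_tendsto_ae
  refine ⟨Lp.aestronglyMeasurable v, ?_⟩
  filter_upwards [hφ, ae_all_iff.2 fun j => (hu (φ j)).2] with x hx hxK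
  exact hK.mem_of_tendsto hx (.of_forall hxK)

theorem isBounded_setOf_Lp_mem_aeMapsInto [IsFiniteMeasure ν] [Fact (1 ≤ r)]
    (hK : Bornology.IsBounded K) :
    Bornology.IsBounded {u : Lp E r ν | ⇑u ∈ aeMapsInto ν K} := by
  obtain ⟨R, hR₀, hR⟩ := hK.exists_pos_norm_le
  exact isBounded_iff_forall_norm_le.2 ⟨_, fun u hu =>
    Lp.norm_le_of_ae_bound hR₀.le (hu.2.mono fun x hx => hR _ hx)⟩

theorem memLp_of_mem_aeMapsInto [IsFiniteMeasure ν] (hK : Bornology.IsBounded K) {u : X → E}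
    (hu : u ∈ aeMapsInto ν K) : MemLp u r ν := by
  obtain ⟨R, hR⟩ := hK.exists_norm_le
  exact .of_bound hu.1 R (hu.2.mono fun x hx => hR _ hx)

theorem coeFn_combo_Lp [NormedSpace ℝ E] (a b : ℝ) (u v : Lp E r ν) :
    ⇑(a • u + b • v) =ᵐ[ν] a • ⇑u + b • ⇑v :=
  (Lp.coeFn_add (a • u) (b • v)).trans ((Lp.coeFn_smul a u).add (Lp.coeFn_smul b v))

theorem quasiconvexOn_Lp_pairEnergy [NormedSpace ℝ E] [StrictConvexSpace ℝ E]
    (hp : 1 < p) (hμ : μ ≪ ν) (hκ : κ ≪ ν.prod ν) (hf : AEStronglyMeasurable f μ)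
    (hK : Convex ℝ K) :
    QuasiconvexOn ℝ {u : Lp E r ν | ⇑u ∈ aeMapsInto ν K} fun u => pairEnergy μ κ p f u := by
  intro c u hu v hv a b ha hb hab
  have hcombo := coeFn_combo_Lp a b u v
  simp only [Set.mem_ofPred_eq, aeMapsInto_congr_ae hcombo, pairEnergy_congr_ae hμ hκ hcombo]
  exact quasiconvexOn_pairEnergy hp hμ hκ hf hK c hu hv ha hb hab

theorem exists_isMinOn_pairEnergy [InnerProductSpace ℝ E] [CompleteSpace E] [IsFiniteMeasure ν]
    (hp : 1 < p) (hμ : μ ≪ ν) (hκ : κ ≪ ν.prod ν) (hf : AEStronglyMeasurable f μ)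
    (hKne : K.Nonempty) (hKcl : IsClosed K) (hKconv : Convex ℝ K) (hKb : Bornology.IsBounded K) :
    ∃ u ∈ aeMapsInto ν K, IsMinOn (pairEnergy μ κ p f) (aeMapsInto ν K) u := by
  have hlift : ∀ v (hv : v ∈ aeMapsInto ν K),
      ⇑((memLp_of_mem_aeMapsInto (r := 2) hKb hv).toLp v) ∈ aeMapsInto ν K := fun v hv =>
    (aeMapsInto_congr_ae (memLp_of_mem_aeMapsInto hKb hv).coeFn_toLp).2 hv
  obtain ⟨y, hy⟩ := hKne
  obtain ⟨u, hu, humin⟩ := exists_isMinOn_of_quasiconvexOn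
    (S := {u : Lp E 2 ν | ⇑u ∈ aeMapsInto ν K})
    ⟨_, hlift (fun _ => y) ⟨aestronglyMeasurable_const, .of_forall fun _ => hy⟩⟩
    (isClosed_setOf_Lp_mem_aeMapsInto hKcl) (isBounded_setOf_Lp_mem_aeMapsInto hKb)
    (quasiconvexOn_Lp_pairEnergy hp hμ hκ hf hKconv) (lowerSemicontinuous_pairEnergy hμ hκ hf)
  refine ⟨u, hu, fun v hv => ?_⟩
  rw [Set.mem_ofPred_eq,
    ← pairEnergy_congr_ae hμ hκ (memLp_of_mem_aeMapsInto (r := 2) hKb hv).coeFn_toLp]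
  exact humin (hlift v hv)

end Existence

section Connected

variable {X Y : Type*} [MeasurableSpace X] {μ : Measure X} {Ω : Set X}

section Topological

variable [TopologicalSpace X]

/- Along the filter `𝓝 x ⊓ ae μ` a property holds almost everywhere near `x`. -/
theorem eventually_nhds_eventually_nhds_inf_ae {P : X → Prop} {x : X}
    (h : ∀ᶠ y in 𝓝 x ⊓ ae μ, P y) : ∀ᶠ x' in 𝓝 x, ∀ᶠ y in 𝓝 x' ⊓ ae μ, P y := by
  obtain ⟨s, hs, t, ht, hst⟩ := eventually_inf.1 h
  filter_upwards [eventually_mem_nhds_iff.2 hs] with x' hx'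
  exact eventually_inf.2 ⟨s, hx', t, ht, hst⟩

theorem nhds_inf_ae_neBot [μ.IsOpenPosMeasure] (x : X) : (𝓝 x ⊓ ae μ).NeBot := by
  refine inf_neBot_iff.2 fun s hs t ht => ?_
  by_contra hst
  refine (Measure.measure_pos_of_mem_nhds μ hs).ne' (measure_mono_null (fun y hy => ?_) ht)
  exact fun hyt => hst ⟨y, hy, hyt⟩

variable [SecondCountableTopology X] [OpensMeasurableSpace X] [μ.IsOpenPosMeasure]

theorem ae_eq_const_of_locally_ae_eq_const (hΩo : IsOpen Ω) (hΩc : IsPreconnected Ω)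
    (hΩne : Ω.Nonempty) {h : X → Y} (hloc : ∀ x ∈ Ω, ∃ c, ∀ᶠ y in 𝓝 x ⊓ ae μ, h y = c) :
    ∃ c, ∀ᵐ x ∂μ.restrict Ω, h x = c := by
  obtain ⟨x₀, hx₀⟩ := hΩne
  have : Nonempty Y := ⟨(hloc x₀ hx₀).choose⟩
  choose! c hc using hloc
  have hconst : ∀ x ∈ Ω, ∀ y ∈ Ω, c x = c y := fun x hx y hy => by
    refine hΩc.induction₂ (fun x y => c x = c y) (fun x hx => ?_)
      (fun _ _ _ _ _ _ => Eq.trans) (fun _ _ _ _ => Eq.symm) hx hy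
    filter_upwards [mem_nhdsWithin_of_mem_nhds
      (eventually_nhds_eventually_nhds_inf_ae (hc x hx)), self_mem_nhdsWithin] with y hxy hy
    have := nhds_inf_ae_neBot (μ := μ) y
    obtain ⟨w, hwx, hwy⟩ := (hxy.and (hc y hy)).exists
    exact hwx.symm.trans hwy
  refine ⟨c x₀, (ae_restrict_iff' hΩo.measurableSet).2 (measure_null_of_locally_null _ ?_)⟩
  intro x hx
  obtain ⟨hxΩ, -⟩ := Classical.not_imp.1 hx
  obtain ⟨s, hs, t, ht, hst⟩ := eventually_inf.1 (hc x hxΩ)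
  have hsub : {y | ¬(y ∈ Ω → h y = c x₀)} ∩ s ⊆ tᶜ := fun y hy hyt =>
    hy.1 fun _ => (hst y ⟨hy.2, hyt⟩).trans (hconst x hxΩ x₀ hx₀)
  exact ⟨_, inter_mem_nhdsWithin _ hs, measure_mono_null hsub (mem_ae_iff.1 ht)⟩

end Topological

variable [PseudoMetricSpace X] [OpensMeasurableSpace X] [μ.IsOpenPosMeasure] {η : ℝ}

theorem exists_eventually_nhds_inf_ae_eq_const [SFinite μ] (hΩo : IsOpen Ω) {h : X → Y}
    (hη : 0 < η) (hloc : ∀ᵐ q ∂(μ.restrict Ω).prod (μ.restrict Ω),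
      dist q.1 q.2 < η → h q.1 = h q.2) {x : X} (hx : x ∈ Ω) :
    ∃ c, ∀ᶠ y in 𝓝 x ⊓ ae μ, h y = c := by
  have hball : Metric.ball x (η / 2) ∩ Ω ∈ 𝓝 x :=
    inter_mem (Metric.ball_mem_nhds x (half_pos hη)) (hΩo.mem_nhds hx)
  have hae := (ae_restrict_iff' hΩo.measurableSet).1 (Measure.ae_ae_of_ae_prod hloc)
  have := nhds_inf_ae_neBot (μ := μ) x
  obtain ⟨x₀, hx₀, hx₀ae⟩ :=
    ((eventually_inf.2 ⟨_, hball, _, hae, fun y hy => hy⟩ : ∀ᶠ y in 𝓝 x ⊓ ae μ, _)).exists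
  refine ⟨h x₀, eventually_inf.2 ⟨_, hball, _,
    (ae_restrict_iff' hΩo.measurableSet).1 (hx₀ae hx₀.2), fun y ⟨hy, hyae⟩ => ?_⟩⟩
  refine (hyae hy.2 ?_).symm
  calc dist x₀ y ≤ dist x₀ x + dist y x := dist_triangle_right _ _ _
    _ < η / 2 + η / 2 := add_lt_add hx₀.1 hy.1
    _ = η := add_halves η

theorem ae_eq_of_increments_ae_eq [SecondCountableTopology X] [SFinite μ] {E : Type*}
    [AddCommGroup E] (hΩo : IsOpen Ω) (hΩc : IsPreconnected Ω) {μ' : Measure X}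
    (hμ' : μ' ≪ μ.restrict Ω) (hμ'₀ : μ' ≠ 0) {u v : X → E} (huv : u =ᵐ[μ'] v) (hη : 0 < η)
    (hincr : ∀ᵐ q ∂(μ.restrict Ω).prod (μ.restrict Ω),
      dist q.1 q.2 < η → u q.1 - u q.2 = v q.1 - v q.2) :
    u =ᵐ[μ.restrict Ω] v := by
  have hΩne : Ω.Nonempty := by
    by_contra hΩ
    rw [Set.not_nonempty_iff_eq_empty.1 hΩ, Measure.restrict_empty] at hμ'
    exact hμ'₀ (Measure.absolutelyContinuous_zero_iff.1 hμ')
  have hdiff : ∀ᵐ q ∂(μ.restrict Ω).prod (μ.restrict Ω),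
      dist q.1 q.2 < η → u q.1 - v q.1 = u q.2 - v q.2 :=
    hincr.mono fun q hq hdist => sub_eq_sub_iff_sub_eq_sub.2 (hq hdist)
  obtain ⟨c, hc⟩ := ae_eq_const_of_locally_ae_eq_const (h := fun x => u x - v x) hΩo hΩc hΩne
    fun x hx => exists_eventually_nhds_inf_ae_eq_const hΩo hη hdiff hx
  have : (ae μ').NeBot := ae_neBot.2 hμ'₀
  obtain ⟨x, hx, hxc⟩ := (huv.and (hμ'.ae_le hc)).exists
  have hc₀ : c = 0 := by rw [← hxc, hx, sub_self]
  exact hc.mono fun x hx => sub_eq_zero.1 (hx.trans hc₀)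

end Connected

attribute [local instance] Matrix.frobeniusNormedRing Matrix.frobeniusNormedAlgebra
  Matrix.frobeniusNormedSpace

theorem frobenius_parallelogram_law {ι κ : Type*} [Fintype ι] [Fintype κ] (A B : Matrix ι κ ℝ) :
    ‖A + B‖ * ‖A + B‖ + ‖A - B‖ * ‖A - B‖ = 2 * (‖A‖ * ‖A‖ + ‖B‖ * ‖B‖) := by
  let e (A : Matrix ι κ ℝ) : PiLp 2 fun _ : ι => EuclideanSpace ℝ κ :=
    .toLp 2 fun i => .toLp 2 (A i)
  have hadd : e (A + B) = e A + e B := rfl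
  have hsub : e (A - B) = e A - e B := rfl
  have hnorm (C : Matrix ι κ ℝ) : ‖C‖ = ‖e C‖ := rfl
  simp only [hnorm, hadd, hsub, ← sq]
  exact parallelogram_law_with_norm ℝ (e A) (e B)

/-- The inner product of the Frobenius norm on real matrices, obtained from the parallelogram law so
that the norm stays the given one. It makes the `L²` space of matrix-valued maps a Hilbert space. -/
@[reducible] noncomputable def frobeniusInnerProductSpace (ι κ : Type*) [Fintype ι] [Fintype κ] :
    InnerProductSpace ℝ (Matrix ι κ ℝ) :=
  InnerProductSpace.ofNorm ℝ frobenius_parallelogram_law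

attribute [local instance] frobeniusInnerProductSpace

section MatrixLog

variable {m : ℕ} {z : ℝ} {A : Mat m}

open scoped Matrix.Norms.L2Operator MatrixOrder in
theorem exp_matLog (hA : A.PosDef) : NormedSpace.exp (matLog A) = A :=
  CFC.exp_log A

open scoped Matrix.Norms.L2Operator MatrixOrder in
theorem matLog_exp (hA : A.IsHermitian) : matLog (NormedSpace.exp A) = A :=
  CFC.log_exp A hA

open scoped Matrix.Norms.L2Operator MatrixOrder in
theorem posDef_exp (hA : A.IsHermitian) : (NormedSpace.exp A).PosDef := by
  have hcfc : NormedSpace.exp A = cfc Real.exp A := (CFC.real_exp_eq_normedSpace_exp hA).symm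
  rw [← Matrix.isStrictlyPositive_iff_posDef, hcfc, cfc_isStrictlyPositive_iff Real.exp A]
  exact fun x _ => Real.exp_pos x

theorem continuousOn_matLog : ContinuousOn (matLog (m := m)) {A | A.PosDef} :=
  open scoped Matrix.Norms.L2Operator in
  (CFC.continuousOn_log (A := Mat m)).mono fun _ hA => ⟨hA.1, hA.isUnit⟩

theorem exists_lipschitzOnWith_exp (𝔸 : Type*) [NormedRing 𝔸] [NormedAlgebra ℝ 𝔸]
    [FiniteDimensional ℝ 𝔸] (R : ℝ) :
    ∃ L, LipschitzOnWith L (NormedSpace.exp : 𝔸 → 𝔸) (Metric.closedBall 0 R) := by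
  have : ProperSpace 𝔸 := FiniteDimensional.proper ℝ 𝔸
  have : CompleteSpace 𝔸 := FiniteDimensional.complete ℝ 𝔸
  have hexp : ContDiff ℝ 1 (NormedSpace.exp : 𝔸 → 𝔸) :=
    contDiff_iff_contDiffAt.2 fun x => (NormedSpace.exp_analytic (𝕂 := ℝ) x).contDiffAt
  exact hexp.contDiffOn.exists_lipschitzOnWith one_ne_zero (convex_closedBall _ _)
    (isCompact_closedBall _ _)

/-- The symmetric matrices of Frobenius norm at most `z`: the image of `SPDLog m z` in logarithmic
coordinates. -/
def symBall (m : ℕ) (z : ℝ) : Set (Mat m) :=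
  {A | A.IsHermitian} ∩ Metric.closedBall 0 z

theorem zero_mem_symBall (hz : 0 ≤ z) : (0 : Mat m) ∈ symBall m z :=
  ⟨Matrix.isHermitian_zero, Metric.mem_closedBall_self hz⟩

theorem isClosed_symBall : IsClosed (symBall m z) :=
  (isClosed_eq continuous_id.matrix_conjTranspose continuous_id).inter Metric.isClosed_closedBall

theorem isBounded_symBall : Bornology.IsBounded (symBall m z) :=
  Metric.isBounded_closedBall.subset Set.inter_subset_right

theorem isCompact_symBall : IsCompact (symBall m z) :=
  have : ProperSpace (Mat m) := FiniteDimensional.proper ℝ _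
  Metric.isCompact_of_isClosed_isBounded isClosed_symBall isBounded_symBall

theorem convex_symBall : Convex ℝ (symBall m z) :=
  (selfAdjoint.submodule ℝ (Mat m)).convex.inter (convex_closedBall _ _)

theorem mapsTo_matLog : Set.MapsTo matLog (SPDLog m z) (symBall m z) := fun A hA =>
  ⟨cfc_predicate Real.log A, mem_closedBall_zero_iff.2 hA.2⟩

theorem mapsTo_exp : Set.MapsTo NormedSpace.exp (symBall m z) (SPDLog m z) := fun _ hA =>
  ⟨posDef_exp hA.1, by rw [matLog_exp hA.1]; exact mem_closedBall_zero_iff.1 hA.2⟩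

theorem image_exp_symBall : NormedSpace.exp '' symBall m z = SPDLog m z :=
  mapsTo_exp.image_subset.antisymm fun A hA => ⟨matLog A, mapsTo_matLog hA, exp_matLog hA.1⟩

theorem isCompact_SPDLog : IsCompact (SPDLog m z) :=
  image_exp_symBall (m := m) ▸ isCompact_symBall.image NormedSpace.exp_continuous

theorem injOn_matLog : Set.InjOn matLog {A : Mat m | A.PosDef} := fun A hA B hB hAB => by
  rw [← exp_matLog hA, hAB, exp_matLog hB]

theorem exists_norm_sub_le_mul_logDist (m : ℕ) (z : ℝ) :
    ∃ L : ℝ≥0, ∀ A ∈ SPDLog m z, ∀ B ∈ SPDLog m z, ‖A - B‖ ≤ L * logDist A B := by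
  obtain ⟨L, hL⟩ : ∃ L, LipschitzOnWith L (NormedSpace.exp : Mat m → Mat m)
    (Metric.closedBall 0 z) := exists_lipschitzOnWith_exp (Mat m) z
  refine ⟨L, fun A hA B hB => ?_⟩
  have h := hL.dist_le_mul _ (mapsTo_matLog hA).2 _ (mapsTo_matLog hB).2
  rwa [exp_matLog hA.1, exp_matLog hB.1, dist_eq_norm, dist_eq_norm] at h

end MatrixLog

section Interaction

/-- The measure `k(x - y) / ‖x - y‖ᵃ dν(x) dν(y)` that weights the pairs of points in a nonlocal
regularization term. -/
noncomputable def interactionMeasure {V : Type*} [NormedAddCommGroup V] [MeasurableSpace V]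
    (ν : Measure V) (a : ℝ) (k : V → ℝ) : Measure (V × V) :=
  (ν.prod ν).withDensity fun q => ENNReal.ofReal (k (q.1 - q.2) / ‖q.1 - q.2‖ ^ a)

variable {V : Type*} [NormedAddCommGroup V] [MeasurableSpace V] {ν : Measure V} {k : V → ℝ}
  {a b p τ η L R : ℝ}

theorem interactionMeasure_absolutelyContinuous (ν : Measure V) (a : ℝ) (k : V → ℝ) :
    interactionMeasure ν a k ≪ ν.prod ν :=
  withDensity_absolutelyContinuous _ _

/- Here `t` is the distance of two points and `c` the value of the kernel, bounded below only near
the diagonal; far from it the left side is bounded since `d` is. -/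
theorem rpow_div_rpow_le_near_add_far {c d e t : ℝ} (hp : 0 ≤ p) (ha : 0 ≤ a) (hτ : 0 < τ)
    (hη : 0 < η) (hL : 0 ≤ L) (hc : 0 ≤ c) (hd : 0 ≤ d) (he : 0 ≤ e) (ht : 0 ≤ t)
    (hde : d ≤ L * e) (hdR : d ≤ R) (hnear : t < η → τ ≤ c) :
    d ^ p / t ^ a ≤ L ^ p / τ * (c / t ^ a * e ^ p) + R ^ p / η ^ a := by
  have hR : 0 ≤ R := hd.trans hdR
  rcases lt_or_ge t η with htη | htη
  · have hcτ := hnear htη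
    calc d ^ p / t ^ a ≤ (L * e) ^ p / t ^ a := by gcongr
      _ = L ^ p / τ * (τ / t ^ a * e ^ p) := by rw [Real.mul_rpow hL he]; field_simp
      _ ≤ L ^ p / τ * (c / t ^ a * e ^ p) := by gcongr
      _ ≤ _ := le_add_of_nonneg_right (by positivity)
  · calc d ^ p / t ^ a ≤ R ^ p / η ^ a := by gcongr
      _ ≤ _ := le_add_of_nonneg_left (by positivity)

theorem enorm_norm_div_rpow_le_near_add_far {E F : Type*} [NormedAddCommGroup E]
    [NormedAddCommGroup F] {c t : ℝ} (hp : 0 ≤ p) (hb : 0 ≤ b) (hτ : 0 < τ) (hη : 0 < η)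
    (hL : 0 ≤ L) (hc : 0 ≤ c) (ht : 0 ≤ t) {y : E} {y' : F} (hyy' : ‖y‖ ≤ L * ‖y'‖)
    (hyR : ‖y‖ ≤ R) (hnear : t < η → τ ≤ c) :
    ‖‖y‖ / t ^ b‖ₑ ^ p ≤
      ENNReal.ofReal (L ^ p / τ) * (ENNReal.ofReal (c / t ^ (b * p)) * ‖y'‖ₑ ^ p) +
        ENNReal.ofReal (R ^ p / η ^ (b * p)) := by
  have hR : 0 ≤ R := (norm_nonneg y).trans hyR
  rw [enorm_rpow_eq_ofReal _ hp, enorm_rpow_eq_ofReal _ hp, ← ENNReal.ofReal_mul (by positivity),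
    ← ENNReal.ofReal_mul (by positivity), ← ENNReal.ofReal_add (by positivity) (by positivity),
    Real.norm_of_nonneg (by positivity), Real.div_rpow (norm_nonneg y) (by positivity),
    ← Real.rpow_mul ht]
  exact ENNReal.ofReal_le_ofReal (rpow_div_rpow_le_near_add_far hp (by positivity) hτ hη hL hc
    (norm_nonneg y) (norm_nonneg y') ht hyy' hyR hnear)

variable [BorelSpace V] [SecondCountableTopology V]

theorem measurable_interactionDensity (a : ℝ) (hk : Measurable k) :
    Measurable fun q : V × V => ENNReal.ofReal (k (q.1 - q.2) / ‖q.1 - q.2‖ ^ a) :=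
  ((hk.comp measurable_sub).div (measurable_sub.norm.pow_const a)).ennreal_ofReal

theorem lintegral_interactionMeasure (hk : Measurable k) (F : V × V → ℝ≥0∞) :
    ∫⁻ q, F q ∂interactionMeasure ν a k =
      ∫⁻ q, ENNReal.ofReal (k (q.1 - q.2) / ‖q.1 - q.2‖ ^ a) * F q ∂ν.prod ν :=
  lintegral_withDensity_eq_lintegral_mul_non_measurable _ (measurable_interactionDensity a hk)
    (.of_forall fun _ => ENNReal.ofReal_lt_top) F

theorem ae_prod_of_ae_interactionMeasure {P : V × V → Prop} (hk : Measurable k)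
    (hkpos : ∀ x, ‖x‖ < η → 0 < k x) (hdiag : ∀ x, P (x, x))
    (h : ∀ᵐ q ∂interactionMeasure ν a k, P q) :
    ∀ᵐ q ∂ν.prod ν, dist q.1 q.2 < η → P q := by
  filter_upwards [(ae_withDensity_iff (measurable_interactionDensity a hk)).1 h] with ⟨x, y⟩ hq hxy
  -- On the diagonal the density may vanish, since `t / 0 = 0`.
  rcases eq_or_ne x y with rfl | hne
  · exact hdiag x
  · refine hq (ENNReal.ofReal_pos.2 (div_pos (hkpos _ ?_) (Real.rpow_pos_of_pos ?_ a))).ne'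
    · rwa [← dist_eq_norm]
    · exact norm_sub_pos_iff.2 hne

theorem ae_eq_of_isMinOn_pairEnergy_interactionMeasure {E : Type*} [NormedAddCommGroup E]
    [NormedSpace ℝ E] [StrictConvexSpace ℝ E] {μ μ' : Measure V} [SFinite μ] [μ.IsOpenPosMeasure]
    {Ω : Set V} (hΩo : IsOpen Ω) (hΩc : IsPreconnected Ω) (hμ' : μ' ≪ μ.restrict Ω) (hμ'₀ : μ' ≠ 0)
    (hp : 1 < p) (hk : Measurable k) (hkpos : ∀ᶠ x in 𝓝 0, 0 < k x) {f u v : V → E}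
    (hf : AEStronglyMeasurable f μ') {K : Set E} (hK : Convex ℝ K)
    (hu : u ∈ aeMapsInto (μ.restrict Ω) K) (hv : v ∈ aeMapsInto (μ.restrict Ω) K)
    (humin : IsMinOn (pairEnergy μ' (interactionMeasure (μ.restrict Ω) a k) p f)
      (aeMapsInto (μ.restrict Ω) K) u)
    (hvmin : IsMinOn (pairEnergy μ' (interactionMeasure (μ.restrict Ω) a k) p f)
      (aeMapsInto (μ.restrict Ω) K) v)
    (hfin : pairEnergy μ' (interactionMeasure (μ.restrict Ω) a k) p f u ≠ ⊤) :
    u =ᵐ[μ.restrict Ω] v := by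
  obtain ⟨η, hη, hηk⟩ := Metric.eventually_nhds_iff.1 hkpos
  obtain ⟨huv, hincr⟩ := increments_ae_eq_of_isMinOn_pairEnergy hp hμ'
    (interactionMeasure_absolutelyContinuous _ a k) hf hK hu hv humin hvmin hfin
  refine ae_eq_of_increments_ae_eq hΩo hΩc hμ' hμ'₀ huv hη
    (ae_prod_of_ae_interactionMeasure hk (fun x hx => hηk ?_) (fun x => ?_) hincr)
  · rwa [dist_zero_right]
  · rw [sub_self, sub_self]

theorem memLp_norm_sub_div_rpow {E F : Type*} [NormedAddCommGroup E] [NormedAddCommGroup F]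
    [IsFiniteMeasure ν] (hp : 0 < p) (hb : 0 ≤ b) (hk : Measurable k) (hk₀ : ∀ x, 0 ≤ k x)
    (hτ : 0 < τ) (hkτ : ∀ᶠ x in 𝓝 0, τ ≤ k x) (hL : 0 ≤ L) {w : V → E} {u : V → F}
    (hw : AEStronglyMeasurable w ν)
    (hlip : ∀ᵐ q ∂ν.prod ν, ‖w q.1 - w q.2‖ ≤ L * ‖u q.1 - u q.2‖)
    (hR : ∀ᵐ q ∂ν.prod ν, ‖w q.1 - w q.2‖ ≤ R)
    (hfin : ∫⁻ q, ‖u q.1 - u q.2‖ₑ ^ p ∂interactionMeasure ν (b * p) k ≠ ⊤) :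
    MemLp (fun q : V × V => ‖w q.1 - w q.2‖ / ‖q.1 - q.2‖ ^ b) (ENNReal.ofReal p) (ν.prod ν) := by
  obtain ⟨η, hη, hηk⟩ := Metric.eventually_nhds_iff.1 hkτ
  have hpt : ∀ᵐ q ∂ν.prod ν, ‖‖w q.1 - w q.2‖ / ‖q.1 - q.2‖ ^ b‖ₑ ^ p ≤
      ENNReal.ofReal (L ^ p / τ) *
        (ENNReal.ofReal (k (q.1 - q.2) / ‖q.1 - q.2‖ ^ (b * p)) * ‖u q.1 - u q.2‖ₑ ^ p) +
      ENNReal.ofReal (R ^ p / η ^ (b * p)) := by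
    filter_upwards [hlip, hR] with q hqL hqR
    exact enorm_norm_div_rpow_le_near_add_far hp.le hb hτ hη hL (hk₀ _) (norm_nonneg _) hqL hqR
      fun hq => hηk (by rwa [dist_zero_right])
  have hmeas : AEStronglyMeasurable (fun q : V × V => ‖w q.1 - w q.2‖ / ‖q.1 - q.2‖ ^ b)
      (ν.prod ν) :=
    ((aestronglyMeasurable_increment .rfl hw).norm.aemeasurable.div
      (measurable_sub.norm.pow_const b).aemeasurable).aestronglyMeasurable
  refine ⟨hmeas, ?_⟩
  rw [eLpNorm_lt_top_iff_lintegral_rpow_enorm_lt_top (by simpa using hp) ENNReal.ofReal_ne_top,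
    ENNReal.toReal_ofReal hp.le]
  refine (lintegral_mono_ae hpt).trans_lt ?_
  rw [lintegral_add_right _ measurable_const, lintegral_const_mul' _ _ ENNReal.ofReal_ne_top,
    lintegral_const, ← lintegral_interactionMeasure hk]
  exact ENNReal.add_lt_top.2 ⟨ENNReal.mul_lt_top ENNReal.ofReal_lt_top hfin.lt_top,
    ENNReal.mul_lt_top ENNReal.ofReal_lt_top (measure_lt_top _ _)⟩

end Interaction

section LogCoordinates

theorem comp_mem_aeMapsInto {X E F : Type*} [MeasurableSpace X] {ν : Measure X}
    [PseudoMetricSpace E] [PseudoMetricSpace F] [SecondCountableTopologyEither E F] {g : E → F}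
    {K : Set E} {K' : Set F} (hg : ContinuousOn g K) (hK : IsClosed K) (hgK : Set.MapsTo g K K')
    {u : X → E} (hu : u ∈ aeMapsInto ν K) : (fun x => g (u x)) ∈ aeMapsInto ν K' := by
  borelize E
  have hum : AEMeasurable u ν := hu.1.aemeasurable
  have hmap : (ν.map u).restrict K = ν.map u :=
    Measure.restrict_eq_self_of_ae_mem ((ae_map_iff hum hK.measurableSet).2 hu.2)
  have hgm : AEStronglyMeasurable g (ν.map u) := hmap ▸ hg.aestronglyMeasurable hK.measurableSet
  exact ⟨hgm.comp_aemeasurable hum, hu.2.mono fun x hx => hgK hx⟩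

theorem pairEnergy_const_ne_top {X E : Type*} [MeasurableSpace X] [NormedAddCommGroup E]
    {μ : Measure X} [IsFiniteMeasure μ] {κ : Measure (X × X)} {p R : ℝ} {f : X → E} (hp : 0 < p)
    (hf : ∀ᵐ x ∂μ, ‖f x‖ ≤ R) (c : E) : pairEnergy μ κ p f (fun _ => c) ≠ ⊤ := by
  have hpt : ∀ᵐ x ∂μ, ‖c - f x‖ₑ ^ p ≤ ENNReal.ofReal ((‖c‖ + R) ^ p) := by
    filter_upwards [hf] with x hx
    rw [enorm_rpow_eq_ofReal _ hp.le]
    have hle : ‖c - f x‖ ≤ ‖c‖ + R := (norm_sub_le c (f x)).trans (by gcongr)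
    gcongr
  simp only [pairEnergy, sub_self, enorm_zero, ENNReal.zero_rpow_of_pos hp, lintegral_zero,
    add_zero]
  refine ne_top_of_le_ne_top ?_ (lintegral_mono_ae hpt)
  rw [lintegral_const]
  exact ENNReal.mul_ne_top ENNReal.ofReal_ne_top (measure_ne_top μ _)

variable {X : Type*} [MeasurableSpace X] {ν : Measure X} {m : ℕ} {z : ℝ}

theorem matLog_comp_mem_aeMapsInto {w : X → Mat m} (hw : w ∈ aeMapsInto ν (SPDLog m z)) :
    (fun x => matLog (w x)) ∈ aeMapsInto ν (symBall m z) :=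
  comp_mem_aeMapsInto (continuousOn_matLog.mono fun _ hA => hA.1) isCompact_SPDLog.isClosed
    mapsTo_matLog hw

theorem exists_Lp_matLog_ae_eq [IsFiniteMeasure ν] (r : ℝ≥0∞) {u : X → Mat m}
    (hu : u ∈ aeMapsInto ν (symBall m z)) :
    ∃ w : Lp (Mat m) r ν, ⇑w ∈ aeMapsInto ν (SPDLog m z) ∧ (fun x => matLog (w x)) =ᵐ[ν] u := by
  have hexp : (fun x => NormedSpace.exp (u x)) ∈ aeMapsInto ν (SPDLog m z) :=
    comp_mem_aeMapsInto NormedSpace.exp_continuous.continuousOn isClosed_symBall mapsTo_exp hu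
  have hmem := memLp_of_mem_aeMapsInto (r := r) isCompact_SPDLog.isBounded hexp
  refine ⟨hmem.toLp _, (aeMapsInto_congr_ae hmem.coeFn_toLp).2 hexp, ?_⟩
  filter_upwards [hmem.coeFn_toLp, hu.2] with x hx hux
  rw [hx, matLog_exp hux.1]

end LogCoordinates

section Functional

/-- The functional `F` in the logarithmic coordinate `u = Log w`: there it is a pair energy, hence
convex. -/
noncomputable def logEnergy {n m : ℕ} (Ω D : Set (Rn n)) (s p α : ℝ) (ρ : Rn n → ℝ) (l : ℕ)
    (v u : Rn n → Mat m) : ℝ≥0∞ :=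
  pairEnergy (volume.restrict (Ω \ D))
    (interactionMeasure (volume.restrict Ω) (n + p * s) fun x => α * ρ x ^ l) p
    (fun x => matLog (v x)) u

variable {n m : ℕ} {Ω D : Set (Rn n)} {s p α τ z : ℝ} {ρ : Rn n → ℝ} {l : ℕ}
  {v : Rn n → Mat m}

theorem functionalF_eq_logEnergy (hΩD : MeasurableSet (Ω \ D)) (hp : 0 ≤ p) (hα : 0 ≤ α)
    (hρ : Measurable ρ) (v w : Rn n → Mat m) :
    functionalF Ω D s p α ρ l v w = logEnergy Ω D s p α ρ l v fun x => matLog (w x) := by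
  rw [functionalF, regularizer, logEnergy, pairEnergy,
    lintegral_interactionMeasure ((hρ.pow_const l).const_mul α), lintegral_indicator hΩD,
    Measure.restrict_restrict hΩD, Set.inter_eq_left.2 Set.sdiff_subset,
    ← lintegral_const_mul' _ _ ENNReal.ofReal_ne_top]
  congr 1
  · simp only [enorm_rpow_eq_ofReal _ hp, logDist]
  · refine lintegral_congr fun q => ?_
    rw [enorm_rpow_eq_ofReal _ hp, ← ENNReal.ofReal_mul hα,
      ← ENNReal.ofReal_mul' (Real.rpow_nonneg (norm_nonneg _) p), logDist]
    ring_nf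

theorem restrict_sdiff_absolutelyContinuous :
    (volume : Measure (Rn n)).restrict (Ω \ D) ≪ volume.restrict Ω :=
  (Measure.restrict_mono_set volume Set.sdiff_subset).absolutelyContinuous

theorem logEnergy_congr_ae {u u' : Rn n → Mat m} (h : u =ᵐ[volume.restrict Ω] u') :
    logEnergy Ω D s p α ρ l v u = logEnergy Ω D s p α ρ l v u' :=
  pairEnergy_congr_ae restrict_sdiff_absolutelyContinuous
    (interactionMeasure_absolutelyContinuous _ _ _) h

theorem mem_fracSobolevSet_of_logEnergy_ne_top [IsFiniteMeasure (volume.restrict Ω)] (hp : 0 < p)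
    (hs : 0 ≤ (n : ℝ) / p + s) (hα : 0 < α) (hρ : Measurable ρ) (hρ₀ : ∀ x, 0 ≤ ρ x) (hτ : 0 < τ)
    (hρτ : ∀ᶠ x in 𝓝 0, τ ≤ ρ x) {w : LpMat m Ω p}
    (hw : ∀ᵐ x ∂volume.restrict Ω, w x ∈ SPDLog m z)
    (hfin : logEnergy Ω D s p α ρ l v (fun x => matLog (w x)) ≠ ⊤) :
    w ∈ fracSobolevSet Ω s p (SPDLog m z) := by
  obtain ⟨L, hL⟩ := exists_norm_sub_le_mul_logDist m z
  obtain ⟨R, hR⟩ := (isCompact_SPDLog (m := m) (z := z)).isBounded.exists_norm_le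
  have hw₂ : ∀ᵐ q ∂(volume.restrict Ω).prod (volume.restrict Ω),
      w q.1 ∈ SPDLog m z ∧ w q.2 ∈ SPDLog m z :=
    (Measure.quasiMeasurePreserving_fst.ae hw).and (Measure.quasiMeasurePreserving_snd.ae hw)
  have hexp : (n : ℝ) + p * s = (n / p + s) * p := by field_simp
  refine ⟨memLp_norm_sub_div_rpow hp hs ((hρ.pow_const l).const_mul α)
    (fun x => mul_nonneg hα.le (pow_nonneg (hρ₀ x) l)) (mul_pos hα (pow_pos hτ l)) ?_ L.coe_nonneg
    (u := fun x => matLog (w x)) (Lp.aestronglyMeasurable w) (hw₂.mono fun q hq => hL _ hq.1 _ hq.2)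
    (hw₂.mono fun q hq => norm_sub_le_of_le (hR _ hq.1) (hR _ hq.2)) ?_, hw⟩
  · filter_upwards [hρτ] with x hx
    gcongr
  · exact hexp ▸ (ENNReal.add_ne_top.1 hfin).2

theorem isMinOn_functionalF_iff [IsFiniteMeasure (volume.restrict Ω)]
    (hΩD : MeasurableSet (Ω \ D)) (hp : 0 < p) (hs : 0 ≤ (n : ℝ) / p + s) (hα : 0 < α)
    (hρ : Measurable ρ) (hρ₀ : ∀ x, 0 ≤ ρ x) (hτ : 0 < τ) (hρτ : ∀ᶠ x in 𝓝 0, τ ≤ ρ x)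
    {w : LpMat m Ω p} :
    IsMinOn (fun w : LpMat m Ω p => functionalF Ω D s p α ρ l v w)
        (fracSobolevSet Ω s p (SPDLog m z)) w ↔
      IsMinOn (logEnergy Ω D s p α ρ l v) (aeMapsInto (volume.restrict Ω) (symBall m z))
        fun x => matLog (w x) := by
  simp only [isMinOn_iff, functionalF_eq_logEnergy hΩD hp.le hα.le hρ]
  refine ⟨fun h u hu => ?_, fun h w' hw' =>
    h _ (matLog_comp_mem_aeMapsInto ⟨Lp.aestronglyMeasurable w', hw'.2⟩)⟩
  obtain ⟨w', hw', hlog⟩ := exists_Lp_matLog_ae_eq (ENNReal.ofReal p) hu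
  rw [← logEnergy_congr_ae hlog]
  by_cases hfin : logEnergy Ω D s p α ρ l v (fun x => matLog (w' x)) = ⊤
  · exact hfin ▸ le_top
  · exact h w' (mem_fracSobolevSet_of_logEnergy_ne_top hp hs hα hρ hρ₀ hτ hρτ hw'.2 hfin)

theorem exists_isMinOn_logEnergy [IsFiniteMeasure (volume.restrict Ω)] (hp : 1 < p) (hz : 0 ≤ z)
    (hv : v ∈ aeMapsInto (volume.restrict Ω) (SPDLog m z)) :
    ∃ u ∈ aeMapsInto (volume.restrict Ω) (symBall m z),
      IsMinOn (logEnergy Ω D s p α ρ l v) (aeMapsInto (volume.restrict Ω) (symBall m z)) u :=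
  exists_isMinOn_pairEnergy hp restrict_sdiff_absolutelyContinuous
    (interactionMeasure_absolutelyContinuous _ _ _)
    ((matLog_comp_mem_aeMapsInto hv).1.mono_ac restrict_sdiff_absolutelyContinuous)
    ⟨0, zero_mem_symBall hz⟩ isClosed_symBall convex_symBall isBounded_symBall

theorem logEnergy_ne_top_of_isMinOn [IsFiniteMeasure (volume.restrict Ω)] (hp : 0 < p)
    (hz : 0 ≤ z) (hv : v ∈ aeMapsInto (volume.restrict Ω) (SPDLog m z)) {u : Rn n → Mat m}
    (humin : IsMinOn (logEnergy Ω D s p α ρ l v)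
      (aeMapsInto (volume.restrict Ω) (symBall m z)) u) :
    logEnergy Ω D s p α ρ l v u ≠ ⊤ := by
  have : IsFiniteMeasure ((volume : Measure (Rn n)).restrict (Ω \ D)) :=
    isFiniteMeasure_of_le _ (Measure.restrict_mono_set volume Set.sdiff_subset)
  have hbound : ∀ᵐ x ∂volume.restrict (Ω \ D), ‖matLog (v x)‖ ≤ z :=
    restrict_sdiff_absolutelyContinuous.ae_le (hv.2.mono fun _ hx => hx.2)
  exact ne_top_of_le_ne_top (pairEnergy_const_ne_top hp hbound 0)
    (humin ⟨aestronglyMeasurable_const, .of_forall fun _ => zero_mem_symBall hz⟩)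

theorem ae_eq_of_isMinOn_logEnergy [IsFiniteMeasure (volume.restrict Ω)]
    (hΩ_open : IsOpen Ω) (hΩ_conn : IsPreconnected Ω) (hD_vol : volume (Ω \ D) ≠ 0) (hp : 1 < p)
    (hα : 0 < α) (hz : 0 ≤ z) (hρ : Measurable ρ) (hρ_pos : ∀ᶠ x in 𝓝 0, 0 < ρ x)
    (hv : v ∈ aeMapsInto (volume.restrict Ω) (SPDLog m z)) {u u' : Rn n → Mat m}
    (hu : u ∈ aeMapsInto (volume.restrict Ω) (symBall m z))
    (hu' : u' ∈ aeMapsInto (volume.restrict Ω) (symBall m z))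
    (humin : IsMinOn (logEnergy Ω D s p α ρ l v)
      (aeMapsInto (volume.restrict Ω) (symBall m z)) u)
    (humin' : IsMinOn (logEnergy Ω D s p α ρ l v)
      (aeMapsInto (volume.restrict Ω) (symBall m z)) u') :
    u =ᵐ[volume.restrict Ω] u' :=
  ae_eq_of_isMinOn_pairEnergy_interactionMeasure hΩ_open hΩ_conn
    restrict_sdiff_absolutelyContinuous (mt Measure.restrict_eq_zero.1 hD_vol) hp
    ((hρ.pow_const l).const_mul α) (hρ_pos.mono fun _ hx => mul_pos hα (pow_pos hx l))
    ((matLog_comp_mem_aeMapsInto hv).1.mono_ac restrict_sdiff_absolutelyContinuous)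
    convex_symBall hu hu' humin humin'
    (logEnergy_ne_top_of_isMinOn (one_pos.trans hp) hz hv humin)

theorem IsMollifier.exists_eventually_le (hρ : IsMollifier ρ) :
    ∃ τ > 0, ∀ᶠ x in 𝓝 0, τ ≤ ρ x := by
  obtain ⟨τ, hτ, -, η, hη, hset⟩ := hρ.superlevel
  exact ⟨τ, hτ, mem_of_superset (Metric.closedBall_mem_nhds 0 hη) hset.ge⟩

end Functional

theorem mainTheorem1_general (n m : ℕ) (Ω D : Set (Rn n)) (hΩ_vol : volume Ω ≠ ⊤)
    (hΩ_conn : IsPreconnected Ω) (hΩ_open : IsOpen Ω) (hD_meas : MeasurableSet D)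
    (hD_vol : volume (Ω \ D) ≠ 0) (p s α z τ : ℝ) (hp : 1 < p) (hs : 0 ≤ (n : ℝ) / p + s)
    (hα : 0 < α) (hz : 0 ≤ z) (l : ℕ) (ρ : Rn n → ℝ) (hρ : Measurable ρ) (hρ₀ : ∀ x, 0 ≤ ρ x)
    (hτ : 0 < τ) (hρτ : ∀ᶠ x in 𝓝 0, τ ≤ ρ x)
    (wδ : LpMat m Ω p) (hwδ : wδ ∈ lebesgueSet Ω p (SPDLog m z)) :
    ∃! w : LpMat m Ω p, w ∈ fracSobolevSet Ω s p (SPDLog m z) ∧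
      IsMinOn (fun u : LpMat m Ω p => functionalF Ω D s p α ρ l wδ u)
        (fracSobolevSet Ω s p (SPDLog m z)) w := by
  have : IsFiniteMeasure (volume.restrict Ω) := isFiniteMeasure_restrict.2 hΩ_vol
  have hp₀ : 0 < p := one_pos.trans hp
  have hΩD : MeasurableSet (Ω \ D) := hΩ_open.measurableSet.diff hD_meas
  have hv : ⇑wδ ∈ aeMapsInto (volume.restrict Ω) (SPDLog m z) := ⟨Lp.aestronglyMeasurable wδ, hwδ⟩
  have hiff (w : LpMat m Ω p) := isMinOn_functionalF_iff (l := l) (v := wδ) (z := z) (w := w) hΩD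
    hp₀ hs hα hρ hρ₀ hτ hρτ
  obtain ⟨u, hu, humin⟩ := exists_isMinOn_logEnergy (D := D) (s := s) (α := α) (ρ := ρ) (l := l)
    hp hz hv
  obtain ⟨w, hw, hwu⟩ := exists_Lp_matLog_ae_eq (ENNReal.ofReal p) hu
  have hwmin := isMinOn_iff.2 fun u' hu' => (logEnergy_congr_ae hwu).trans_le (humin hu')
  have hwW := mem_fracSobolevSet_of_logEnergy_ne_top hp₀ hs hα hρ hρ₀ hτ hρτ hw.2
    (logEnergy_ne_top_of_isMinOn hp₀ hz hv hwmin)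
  refine ⟨w, ⟨hwW, (hiff w).2 hwmin⟩, fun w' ⟨hw', hwmin'⟩ => Lp.ext ?_⟩
  have hlog : (fun x => matLog (w' x)) =ᵐ[volume.restrict Ω] fun x => matLog (w x) :=
    ae_eq_of_isMinOn_logEnergy hΩ_open hΩ_conn hD_vol hp hα hz hρ
      (hρτ.mono fun _ => hτ.trans_le) hv
      (matLog_comp_mem_aeMapsInto ⟨Lp.aestronglyMeasurable w', hw'.2⟩)
      (matLog_comp_mem_aeMapsInto hw) ((hiff w').1 hwmin') hwmin
  filter_upwards [hlog, hw'.2, hw.2] with x hx hxw' hxw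
  exact injOn_matLog hxw'.1 hxw.1 hx

theorem mainTheorem1 (n m : ℕ) (hn : 0 < n)
    (Ω D : Set (Rn n)) (hΩ_ne : Ω.Nonempty) (hΩ_bdd : Bornology.IsBounded Ω)
    (hΩ_conn : IsConnected Ω) (hΩ_open : IsOpen Ω) (hΩ_lip : HasLipschitzBoundary Ω)
    (hD_sub : D ⊆ Ω) (hD_meas : MeasurableSet D) (hD_vol : volume (Ω \ D) ≠ 0)
    (p s α z : ℝ) (hp : 1 < p) (hs : s ∈ Set.Ioo (0 : ℝ) 1) (hα : 0 < α) (hz : 0 ≤ z)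
    (l : ℕ) (hl : l = 0 ∨ l = 1) (ρ : Rn n → ℝ) (hρ : IsMollifier ρ)
    (wδ : LpMat m Ω p) (hwδ : wδ ∈ lebesgueSet Ω p (SPDLog m z)) :
    ∃! w : LpMat m Ω p, w ∈ fracSobolevSet Ω s p (SPDLog m z) ∧
      IsMinOn (fun u : LpMat m Ω p => functionalF Ω D s p α ρ l wδ u)
        (fracSobolevSet Ω s p (SPDLog m z)) w := by
  obtain ⟨τ, hτ, hρτ⟩ := hρ.exists_eventually_le
  exact mainTheorem1_general n m Ω D hΩ_bdd.measure_lt_top.ne hΩ_conn.isPreconnected hΩ_open hD_meas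
    hD_vol p s α z τ hp (add_nonneg (by positivity) hs.1.le) hα hz l ρ
    hρ.contDiff.continuous.measurable hρ.nonneg hτ hρτ wδ hwδ
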